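/- All graphs are finite and simple. Let $G$ be a graph with $n$ vertices. A \emph{restraint} $r$ on $G$ assigns to each vertex $v$ a finite set $r(v)$ of forbidden colours. For a natural number $k$, a \emph{$k$-restraint} on $G$ is a restraint with $|r(v)|=k$ and $r(v)\subseteq\{1,\dots,kn\}$ for every vertex $v$. For a natural number $x$, let $\pi_r(G,x)$ be the number of proper $x$-colourings permitted by $r$, that is, of functions $c:V(G)\to\{1,\dots,x\}$ with $c(u)\ne c(v)$ for every edge $uv$ and $c(v)\notin r(v)$ for every vertex $v$. Let $R_{\max}(G,k)$ be the set of $k$-restraints $r$ on $G$ for which there is $N$ such that $\pi_{r'}(G,x)\le \pi_r(G,x)$ for all $x\ge N$ and all $k$-restraints $r'$ on $G$. A restraint $r$ on a connected bipartite graph with bipartition $(V_1,V_2)$ (one side may be empty if the graph has a single vertex) is called \emph{alternating} if $r$ is constant on $V_1$, constant on $V_2$, and $r(u)\cap r(v)=\emptyset$ for all $u\in V_1$, $v\in V_2$. \textbf{Corollary.} Let $G$ be a bipartite graph, $k$ a natural number, and $r$ a $k$-restraint on $G$. Then $r\in R_{\max}(G,k)$ if and only if, for every connected component $C$ of $G$,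 the restriction of $r$ to the vertices of $C$ is an alternating restraint on $C$. -/

import Mathlib

/-- A restraint on a graph with vertex set `V`: each vertex receives a finite set of
forbidden colours (colours are natural numbers). -/
abbrev Restraint (V : Type*) : Type _ := V → Finset ℕ

/-- The number `π_r(G, x)` of proper `x`-colourings of `G` (colours `1, …, x`) that are
permitted by `r`. -/
noncomputable def numPermitted {V : Type*} (G : SimpleGraph V) (r : Restraint V) (x : ℕ) : ℕ :=
  Nat.card {c : G.Coloring (Finset.Icc 1 x) // ∀ v, (c v : ℕ) ∉ r v}

/-- `r` is a `k`-restraint: with `n` the number of vertices, every `r v` is a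
`k`-element subset of `{1, …, k n}`. -/
def IsKRestraint {V : Type*} [Fintype V] (k : ℕ) (r : Restraint V) : Prop :=
  ∀ v, (r v).card = k ∧ r v ⊆ Finset.Icc 1 (k * Fintype.card V)

/-- The set of `k`-restraints that permit, for all sufficiently large `x`, the largest number
of `x`-colourings among all `k`-restraints on `G`. -/
def Rmax {V : Type*} [Fintype V] (G : SimpleGraph V) (k : ℕ) : Set (Restraint V) :=
  {r | IsKRestraint k r ∧
    ∃ N : ℕ, ∀ x : ℕ, N ≤ x → ∀ r' : Restraint V, IsKRestraint k r' →
      numPermitted G r' x ≤ numPermitted G r x}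

/-- `(V₁, V₂)` is a bipartition of `G`: the two parts are disjoint, cover the vertices
(one of them may be empty), and every edge joins `V₁` to `V₂`. -/
def IsBipartition {V : Type*} (G : SimpleGraph V) (V₁ V₂ : Set V) : Prop :=
  G.IsBipartiteWith V₁ V₂ ∧ V₁ ∪ V₂ = Set.univ

/-- A restraint on a connected bipartite graph is alternating if it is constant on each side of
the bipartition and forbidden sets of vertices on different sides are disjoint. (A connected
bipartite graph has only one bipartition up to swapping the sides.) -/
def IsAlternating {V : Type*} (G : SimpleGraph V) (r : Restraint V) : Prop :=
  ∃ V₁ V₂ : Set V, IsBipartition G V₁ V₂ ∧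
    (∀ a ∈ V₁, ∀ a' ∈ V₁, r a = r a') ∧
    (∀ b ∈ V₂, ∀ b' ∈ V₂, r b = r b') ∧
    (∀ a ∈ V₁, ∀ b ∈ V₂, Disjoint (r a) (r b))

/-- The restraint that `r` induces on a connected component of `G`. -/
def Restraint.induced {V : Type*} {G : SimpleGraph V} (r : Restraint V)
    (C : G.ConnectedComponent) : Restraint C :=
  fun v => r v

/-! Inclusion-exclusion over edge sets `S` shows that for x ≥ kn the number of permitted colourings
is a polynomial in x: the alternating sum over `S` of ∏ (x − |r_K|), with K running over the
components of (V, S) and r_K the union of the forbidden sets on K (`numPermitted_eq_eval`).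

Compare a locally alternating `s` with any `r`. Each product is monic of degree c(S), the number of
components, so the terms of `S` can differ only from the coefficient of x^(c(S)−1) downwards, and
there by Σ|r_K| − Σ|s_K|. As `G` has no triangle, c(S) = n − |S| for |S| ≤ 2, and c(S) ≤ n − 3 for
larger `S` (`SimpleGraph.card_connectedComponent_add_min_le`).

If `r` overlaps across some edge, the coefficient of x^(n−2) decides. Only single edges count there;
their sign −1 rewards large unions, and those of `s` are largest. If `r` is disjoint across every
edge, the terms with |S| ≤ 1 cancel and the coefficient of x^(n−3) decides. Only pairs of edges
count there; their sign +1 rewards small unions, and those of `s` are smallest, strictly so at a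
path u, v, w with r(u) ≠ r(w). Two locally alternating restraints give the same polynomial, because
|r_K| is k times the number of colour classes meeting K. -/

/-! ### Inclusion-exclusion for permitted colourings -/

open Classical in
/-- The colours that are forbidden at some vertex of the component `K`. -/
noncomputable def Restraint.onComponent {V : Type*} [Fintype V] {H : SimpleGraph V}
    (r : Restraint V) (K : H.ConnectedComponent) : Finset ℕ :=
  (Finset.univ.filter (fun v => H.connectedComponentMk v = K)).biUnion r

theorem Restraint.mem_onComponent {V : Type*} [Fintype V] {H : SimpleGraph V}
    (r : Restraint V) (K : H.ConnectedComponent) (i : ℕ) :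
    i ∈ r.onComponent K ↔ ∃ v, H.connectedComponentMk v = K ∧ i ∈ r v := by
  simp [Restraint.onComponent]

open Classical Polynomial in
/-- The polynomial counting the permitted colourings that are constant on every
component of `H`. -/
noncomputable def constPoly {V : Type*} [Fintype V] (r : Restraint V) (H : SimpleGraph V) :
    ℝ[X] :=
  ∏ K : H.ConnectedComponent, (X - C ((r.onComponent K).card : ℝ))

open Classical Polynomial in
/-- The restrained chromatic polynomial, as an alternating sum over edge sets. -/
noncomputable def restraintPoly {V : Type*} [Fintype V] (G : SimpleGraph V) (r : Restraint V) :
    ℝ[X] :=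
  ∑ S ∈ G.edgeFinset.powerset,
    (-1) ^ S.card * constPoly r (SimpleGraph.fromEdgeSet (S : Set (Sym2 V)))

/-- A function that is constant on edges is constant on components. -/
theorem SimpleGraph.eq_of_connectedComponentMk_eq {V α : Type*} {H : SimpleGraph V} {f : V → α}
    (hf : ∀ u v, H.Adj u v → f u = f v) {u v : V}
    (h : H.connectedComponentMk u = H.connectedComponentMk v) : f u = f v := by
  obtain ⟨p⟩ := SimpleGraph.ConnectedComponent.exact h
  induction p with
  | nil => rfl
  | cons h' _ ih => exact (hf _ _ h').trans (ih (SimpleGraph.ConnectedComponent.sound ⟨by assumption⟩))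

-- A colouring constant on components is a free choice of one colour per component, avoiding
-- everything forbidden anywhere on it.
open Classical in
theorem card_filter_const {V : Type*} [Fintype V] (r : Restraint V) (H : SimpleGraph V) (x : ℕ) :
    ((Fintype.piFinset fun v => Finset.Icc 1 x \ r v).filter
      (fun c => ∀ u v, H.Adj u v → c u = c v)).card =
    ∏ K : H.ConnectedComponent, (Finset.Icc 1 x \ r.onComponent K).card := by
  rw [← Fintype.card_piFinset]
  symm
  refine Finset.card_bij (fun f _ v => f (H.connectedComponentMk v)) ?_ ?_ ?_
  · intro f hf
    simp only [Fintype.mem_piFinset, Finset.mem_sdiff, Restraint.mem_onComponent,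
      Finset.mem_filter] at hf ⊢
    refine ⟨fun v => ⟨(hf _).1, fun h => (hf _).2 ⟨v, rfl, h⟩⟩, fun u v h => ?_⟩
    rw [SimpleGraph.ConnectedComponent.sound h.reachable]
  · intro f _ g _ h
    funext K
    induction K using SimpleGraph.ConnectedComponent.ind with
    | h v => exact congrFun h v
  · intro c hc
    simp only [Fintype.mem_piFinset, Finset.mem_sdiff, Finset.mem_filter] at hc
    have key : ∀ v, c (H.connectedComponentMk v).out = c v := fun v =>
      SimpleGraph.eq_of_connectedComponentMk_eq hc.2 (Quot.out_eq (H.connectedComponentMk v))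
    refine ⟨fun K => c K.out, ?_, funext key⟩
    simp only [Fintype.mem_piFinset, Finset.mem_sdiff, Restraint.mem_onComponent]
    refine fun K => ⟨(hc.1 _).1, ?_⟩
    rintro ⟨v, rfl, hv⟩
    exact (hc.1 v).2 (key v ▸ hv)

open Classical in
theorem eval_constPoly {V : Type*} [Fintype V] (r : Restraint V) (H : SimpleGraph V) (x : ℕ)
    (hx : ∀ v, r v ⊆ Finset.Icc 1 x) :
    (constPoly r H).eval (x : ℝ) =
      (((Fintype.piFinset fun v => Finset.Icc 1 x \ r v).filter
        (fun c => ∀ u v, H.Adj u v → c u = c v)).card : ℝ) := by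
  rw [card_filter_const, constPoly, Polynomial.eval_prod, Nat.cast_prod]
  refine Finset.prod_congr rfl fun K _ => ?_
  have hsub : r.onComponent K ⊆ Finset.Icc 1 x := by
    intro i hi
    obtain ⟨v, -, hv⟩ := (r.mem_onComponent K i).1 hi
    exact hx v hv
  rw [Finset.card_sdiff_of_subset hsub, Nat.cast_sub (Finset.card_le_card hsub)]
  simp

open Classical in
theorem numPermitted_eq_card {V : Type*} [Fintype V] (G : SimpleGraph V) (r : Restraint V)
    (x : ℕ) :
    numPermitted G r x = ((Fintype.piFinset fun v => Finset.Icc 1 x \ r v).filter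
      (fun c => ∀ u v, G.Adj u v → c u ≠ c v)).card := by
  rw [numPermitted, ← Nat.card_eq_finsetCard]
  refine Nat.card_congr ⟨fun c => ⟨fun v => c.1 v, ?_⟩,
    fun c => ⟨SimpleGraph.Coloring.mk (fun v => ⟨c.1 v, ?_⟩) ?_, ?_⟩, fun c => rfl, fun c => rfl⟩
  · simp only [Finset.mem_filter, Fintype.mem_piFinset, Finset.mem_sdiff]
    exact ⟨fun v => ⟨(c.1 v).2, c.2 v⟩, fun u v h e => c.1.valid h (Subtype.ext e)⟩
  · have := c.2
    simp only [Finset.mem_filter, Fintype.mem_piFinset, Finset.mem_sdiff] at this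
    exact (this.1 v).1
  · have := c.2
    simp only [Finset.mem_filter, Fintype.mem_piFinset, Finset.mem_sdiff] at this
    intro u v h e
    exact this.2 u v h (congrArg Subtype.val e)
  · have := c.2
    simp only [Finset.mem_filter, Fintype.mem_piFinset, Finset.mem_sdiff] at this
    exact fun v => (this.1 v).2

open Classical in
theorem numPermitted_eq_eval {V : Type*} [Fintype V] (G : SimpleGraph V) (r : Restraint V)
    (x : ℕ) (hx : ∀ v, r v ⊆ Finset.Icc 1 x) :
    (numPermitted G r x : ℝ) = (restraintPoly G r).eval (x : ℝ) := by
  -- Properness is the product over edges of 1 − [the ends agree]; expanding it gives the signed sum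
  -- over edge sets.
  have h1 : ∀ c : V → ℕ, (if ∀ u v, G.Adj u v → c u ≠ c v then (1 : ℝ) else 0) =
      ∑ S ∈ G.edgeFinset.powerset, (-1) ^ S.card *
        (if ∀ u v, (SimpleGraph.fromEdgeSet (S : Set (Sym2 V))).Adj u v → c u = c v
          then (1 : ℝ) else 0) := by
    intro c
    have h2 : (if ∀ u v, G.Adj u v → c u ≠ c v then (1 : ℝ) else 0) =
        ∏ e ∈ G.edgeFinset, (1 - if (e.map c).IsDiag then (1 : ℝ) else 0) := by
      split_ifs with h
      · symm
        refine Finset.prod_eq_one fun e he => ?_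
        induction e with
        | h u v =>
          rw [SimpleGraph.mem_edgeFinset, SimpleGraph.mem_edgeSet] at he
          simp [h u v he]
      · push Not at h
        obtain ⟨u, v, huv, hc⟩ := h
        symm
        refine Finset.prod_eq_zero (i := s(u, v)) (by simpa using huv) ?_
        simp [hc]
    rw [h2, Finset.prod_sub]
    refine Finset.sum_congr rfl fun S hS => ?_
    rw [Finset.mem_powerset] at hS
    rw [Finset.prod_const_one, mul_one]
    congr 1
    rw [Finset.prod_boole]
    congr 1
    apply propext
    constructor
    · intro h u v huv
      exact Sym2.mk_isDiag_iff.1 (h s(u, v) (by simpa using huv.1))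
    · intro h e he
      induction e with
      | h u v =>
        have hne : u ≠ v := by
          have := hS he
          rw [SimpleGraph.mem_edgeFinset, SimpleGraph.mem_edgeSet] at this
          exact this.ne
        simpa using h u v (by simp [hne, he])
  rw [numPermitted_eq_card, Finset.card_filter, Nat.cast_sum]
  simp only [Nat.cast_ite, Nat.cast_one, Nat.cast_zero]
  rw [Finset.sum_congr rfl fun c _ => h1 c, Finset.sum_comm, restraintPoly,
    Polynomial.eval_finsetSum]
  refine Finset.sum_congr rfl fun S _ => ?_
  rw [← Finset.mul_sum, Polynomial.eval_mul, eval_constPoly r _ x hx, Finset.card_filter]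
  simp

/-! ### Component counts of small edge sets -/

-- Every component meets the complement of `T`, so there are at most |V| − |T| of them.
open Classical in
theorem SimpleGraph.card_connectedComponent_add_card_le {V : Type*} [Fintype V]
    (H : SimpleGraph V) (T : Finset V) (hT : ∀ t ∈ T, ∃ y ∉ T, H.Reachable t y) :
    Nat.card H.ConnectedComponent + T.card ≤ Fintype.card V := by
  have h : (Finset.univ : Finset H.ConnectedComponent) ⊆ Tᶜ.image H.connectedComponentMk := by
    intro K _
    induction K using SimpleGraph.ConnectedComponent.ind with
    | h v =>
      rw [Finset.mem_image]
      by_cases hv : v ∈ T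
      · obtain ⟨y, hy, hr⟩ := hT v hv
        exact ⟨y, by simpa using hy, (SimpleGraph.ConnectedComponent.sound hr).symm⟩
      · exact ⟨v, by simpa using hv, rfl⟩
  have h1 := (Finset.card_le_card h).trans Finset.card_image_le
  rw [Finset.card_univ, Finset.card_compl, ← Nat.card_eq_fintype_card] at h1
  have := T.card_le_univ
  omega

open Classical in
theorem SimpleGraph.card_le_card_connectedComponent_add_card {V : Type*} [Fintype V]
    (S : Finset (Sym2 V)) :
    Fintype.card V ≤
      Nat.card (SimpleGraph.fromEdgeSet (S : Set (Sym2 V))).ConnectedComponent + S.card := by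
  induction S using Finset.induction_on with
  | empty =>
    refine le_trans ?_ (Nat.le_add_right _ _)
    rw [← Nat.card_eq_fintype_card]
    refine Nat.card_le_card_of_injective
      (SimpleGraph.fromEdgeSet ((∅ : Finset (Sym2 V)) : Set (Sym2 V))).connectedComponentMk ?_
    intro u v h
    exact SimpleGraph.eq_of_connectedComponentMk_eq (f := id) (by simp) h
  | insert e S he ih =>
    rw [Finset.card_insert_of_notMem he]
    set H := SimpleGraph.fromEdgeSet (S : Set (Sym2 V))
    set H' := SimpleGraph.fromEdgeSet ((insert e S : Finset (Sym2 V)) : Set (Sym2 V)) with hH'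
    suffices Nat.card H.ConnectedComponent ≤ Nat.card H'.ConnectedComponent + 1 by omega
    have hle : H ≤ H' := SimpleGraph.fromEdgeSet_mono (by simp)
    induction e with
    | h u v =>
      -- A new edge uv merges at most the components of u and v, so dropping that of v makes the map
      -- on components injective.
      have hinj : Set.InjOn (SimpleGraph.ConnectedComponent.map (SimpleGraph.Hom.ofLE hle))
          ((Finset.univ.erase (H.connectedComponentMk v) : Finset H.ConnectedComponent) :
            Set H.ConnectedComponent) := by
        intro K hK L hL h
        induction K using SimpleGraph.ConnectedComponent.ind with
        | h a =>
        induction L using SimpleGraph.ConnectedComponent.ind with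
        | h b =>
        simp only [Finset.coe_erase, Finset.coe_univ, Set.mem_sdiff, Set.mem_univ,
          Set.mem_singleton_iff, true_and] at hK hL
        have key := SimpleGraph.eq_of_connectedComponentMk_eq (H := H') (u := a) (v := b)
          (f := fun a => if H.connectedComponentMk a = H.connectedComponentMk v then
            H.connectedComponentMk u else H.connectedComponentMk a) ?_ h
        · simpa [hK, hL] using key
        · intro s t hst
          rw [hH', SimpleGraph.fromEdgeSet_adj, Finset.coe_insert, Set.mem_insert_iff] at hst
          obtain ⟨hst | hst, hne⟩ := hst
          · rw [Sym2.eq_iff] at hst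
            obtain ⟨rfl, rfl⟩ | ⟨rfl, rfl⟩ := hst <;> simp
          · have : H.connectedComponentMk s = H.connectedComponentMk t :=
              SimpleGraph.ConnectedComponent.sound
                (SimpleGraph.Adj.reachable ((SimpleGraph.fromEdgeSet_adj _).2 ⟨hst, hne⟩))
            simp only [this]
      have := Finset.card_le_card_of_injOn (t := Finset.univ) _ (fun _ _ => Finset.mem_univ _) hinj
      rw [Finset.card_univ, Finset.card_erase_of_mem (Finset.mem_univ _), Finset.card_univ,
        ← Nat.card_eq_fintype_card, ← Nat.card_eq_fintype_card] at this
      omega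

open Classical in
theorem SimpleGraph.card_connectedComponent_add_card_image_le {V ι : Type*} [Fintype V]
    (H : SimpleGraph V) (S : Finset ι) (p q : ι → V) (hadj : ∀ e ∈ S, H.Adj (p e) (q e))
    (hpq : ∀ e ∈ S, ∀ e' ∈ S, p e ≠ q e') :
    Nat.card H.ConnectedComponent + (S.image q).card ≤ Fintype.card V := by
  refine H.card_connectedComponent_add_card_le _ fun t ht => ?_
  obtain ⟨e, he, rfl⟩ := Finset.mem_image.1 ht
  refine ⟨p e, ?_, (hadj e he).symm.reachable⟩
  rw [Finset.mem_image]
  rintro ⟨e', he', h⟩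
  exact hpq e he e' he' h.symm

-- Two edges share their `q`-end but not their `p`-end. One of these `p`-ends reaches the other, so
-- it can join the image of `q` in the set of dispensable vertices, which gains one.
open Classical in
theorem SimpleGraph.card_connectedComponent_add_card_image_lt {V ι : Type*} [Fintype V]
    (H : SimpleGraph V) (S : Finset ι) (p q : ι → V) (hadj : ∀ e ∈ S, H.Adj (p e) (q e))
    (hpq : ∀ e ∈ S, ∀ e' ∈ S, p e ≠ q e')
    (hinj : ∀ e ∈ S, ∀ e' ∈ S, p e = p e' → q e = q e' → e = e')
    (hS : (S.image q).card < S.card) :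
    Nat.card H.ConnectedComponent + (S.image q).card < Fintype.card V := by
  obtain ⟨e, he, e', he', hne, hq⟩ := Finset.exists_ne_map_eq_of_card_lt_of_maps_to hS
    (f := q) (fun e he => Finset.mem_image_of_mem q he)
  have hp : ∀ f ∈ S, p f ∉ S.image q := by
    intro f hf h
    obtain ⟨f', hf', h⟩ := Finset.mem_image.1 h
    exact hpq f hf f' hf' h.symm
  have hpp : p e' ≠ p e := fun h => hne (hinj e he e' he' h.symm hq)
  have hr : H.Reachable (p e) (p e') :=
    (hadj e he).reachable.trans (hq ▸ (hadj e' he').symm.reachable)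
  have := H.card_connectedComponent_add_card_le (insert (p e) (S.image q)) ?_
  · rw [Finset.card_insert_of_notMem (hp e he)] at this
    omega
  · have h' : p e' ∉ insert (p e) (S.image q) := by
      rw [Finset.mem_insert, not_or]
      exact ⟨hpp, hp e' he'⟩
    intro t ht
    rcases Finset.mem_insert.1 ht with rfl | ht
    · exact ⟨_, h', hr⟩
    · obtain ⟨f, hf, rfl⟩ := Finset.mem_image.1 ht
      by_cases hfe : p f = p e
      · exact ⟨_, h', (hfe ▸ (hadj f hf).symm.reachable : H.Reachable (q f) (p e)).trans hr⟩
      · exact ⟨p f, by rw [Finset.mem_insert, not_or]; exact ⟨hfe, hp f hf⟩,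
          (hadj f hf).symm.reachable⟩

open Classical in
/-- A set of at most three edges of a bipartite graph is acyclic: each of its edges lowers the
number of components, and larger sets have at most as many components as those of size three. -/
theorem SimpleGraph.card_connectedComponent_add_min_le {V : Type*} [Fintype V]
    {G : SimpleGraph V} (χ : G.Coloring (Fin 2)) {S : Finset (Sym2 V)} (hS : S ⊆ G.edgeFinset) :
    Nat.card (SimpleGraph.fromEdgeSet (S : Set (Sym2 V))).ConnectedComponent + min S.card 3
      ≤ Fintype.card V := by
  -- Orient every edge from colour 0 to colour 1, so that no `p`-end is a `q`-end.
  have hends : ∀ e : Sym2 V, ∃ p q : V, e ∈ S → e = s(p, q) ∧ χ p = 0 ∧ χ q = 1 := by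
    intro e
    induction e with
    | h u v =>
      by_cases he : s(u, v) ∈ S
      · have huv : G.Adj u v := by simpa using hS he
        have := χ.valid huv
        by_cases hu : χ u = 0
        · exact ⟨u, v, fun _ => ⟨rfl, hu, by omega⟩⟩
        · exact ⟨v, u, fun _ => ⟨Sym2.eq_swap, by omega, by omega⟩⟩
      · exact ⟨u, v, fun h => (he h).elim⟩
  choose p q hpq using hends
  set H := SimpleGraph.fromEdgeSet (S : Set (Sym2 V))
  have hne : ∀ e ∈ S, ∀ e' ∈ S, p e ≠ q e' := by
    intro e he e' he' h
    have h1 := (hpq e he).2.1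
    rw [h, (hpq e' he').2.2] at h1
    exact one_ne_zero h1
  have hadj : ∀ e ∈ S, H.Adj (p e) (q e) := by
    intro e he
    refine (SimpleGraph.fromEdgeSet_adj _).2 ⟨?_, hne e he e he⟩
    rw [← (hpq e he).1]
    exact he
  have hinj : ∀ e ∈ S, ∀ e' ∈ S, p e = p e' → q e = q e' → e = e' := by
    intro e he e' he' h1 h2
    rw [(hpq e he).1, (hpq e' he').1, h1, h2]
  have hR := H.card_connectedComponent_add_card_image_le S p q hadj hne
  have hR' := H.card_connectedComponent_add_card_image_lt S p q hadj hne hinj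
  have hL := H.card_connectedComponent_add_card_image_le S q p (fun e he => (hadj e he).symm)
    (fun e he e' he' => (hne e' he' e he).symm)
  have hL' := H.card_connectedComponent_add_card_image_lt S q p (fun e he => (hadj e he).symm)
    (fun e he e' he' => (hne e' he' e he).symm) (fun e he e' he' h h' => hinj e he e' he' h' h)
  -- If `p` or `q` is injective on `S`, the weak bound already gives |S|. Otherwise both strict
  -- bounds apply, and they give 3 unless both images are singletons, which forces |S| ≤ 1.
  by_cases h1 : (S.image q).card < S.card <;> by_cases h2 : (S.image p).card < S.card
  · have hpos : ∀ f : Sym2 V → V, (S.image f).card = 0 → S.card = 0 := by simp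
    have hone : (S.image q).card = 1 → (S.image p).card = 1 → S.card ≤ 1 := by
      intro h h'
      obtain ⟨a, ha⟩ := Finset.card_eq_one.1 h
      obtain ⟨b, hb⟩ := Finset.card_eq_one.1 h'
      refine Finset.card_le_one.2 fun e he e' he' => hinj e he e' he' ?_ ?_
      · have h3 := Finset.mem_image_of_mem p he
        have h4 := Finset.mem_image_of_mem p he'
        rw [hb, Finset.mem_singleton] at h3 h4
        rw [h3, h4]
      · have h3 := Finset.mem_image_of_mem q he
        have h4 := Finset.mem_image_of_mem q he'
        rw [ha, Finset.mem_singleton] at h3 h4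
        rw [h3, h4]
    have := hpos p
    have := hpos q
    have := hR' h1
    have := hL' h2
    omega
  all_goals omega

/-! ### Top coefficients of the polynomials -/

theorem Polynomial.eventually_eval_natCast_pos {p : Polynomial ℝ} {d : ℕ} (hd : 0 < p.coeff d)
    (h : ∀ j, d < j → p.coeff j = 0) : ∀ᶠ x : ℕ in Filter.atTop, 0 < p.eval (x : ℝ) := by
  have hdeg : p.natDegree = d :=
    le_antisymm (Polynomial.natDegree_le_iff_coeff_eq_zero.2 h)
      (Polynomial.le_natDegree_of_ne_zero hd.ne')
  rcases Nat.eq_zero_or_pos d with rfl | hpos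
  · rw [Polynomial.eq_C_of_natDegree_eq_zero hdeg]
    simp [hd]
  · have := p.tendsto_atTop_of_leadingCoeff_nonneg
      (Polynomial.natDegree_pos_iff_degree_pos.1 (hdeg ▸ hpos))
      (by rw [Polynomial.leadingCoeff, hdeg]; exact hd.le)
    exact (this.comp tendsto_natCast_atTop_atTop).eventually_gt_atTop 0

open Classical in
theorem constPoly_coeff_sub_eq_zero {V : Type*} [Fintype V] (r s : Restraint V)
    (H : SimpleGraph V) {j : ℕ} (hj : Nat.card H.ConnectedComponent ≤ j) :
    (constPoly r H).coeff j - (constPoly s H).coeff j = 0 := by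
  have hm : ∀ r : Restraint V, (constPoly r H).Monic := fun r =>
    Polynomial.monic_prod_of_monic _ _ fun K _ => Polynomial.monic_X_sub_C _
  have hd : ∀ r : Restraint V, (constPoly r H).natDegree = Nat.card H.ConnectedComponent := by
    intro r
    rw [constPoly, Polynomial.natDegree_prod_of_monic _ _ fun K _ => Polynomial.monic_X_sub_C _]
    simp only [Polynomial.natDegree_X_sub_C, Finset.sum_const, Finset.card_univ, smul_eq_mul,
      mul_one, Nat.card_eq_fintype_card]
  rcases hj.eq_or_lt with rfl | hj
  · have := fun r => (hm r).coeff_natDegree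
    simp only [hd] at this
    rw [this, this, sub_self]
  · rw [Polynomial.coeff_eq_zero_of_natDegree_lt (by rwa [hd]),
      Polynomial.coeff_eq_zero_of_natDegree_lt (by rwa [hd]), sub_self]

open Classical in
theorem constPoly_coeff_card_pred {V : Type*} [Fintype V] (r : Restraint V)
    (H : SimpleGraph V) {j : ℕ} (hj : Nat.card H.ConnectedComponent = j + 1) :
    (constPoly r H).coeff j = -∑ K : H.ConnectedComponent, ((r.onComponent K).card : ℝ) := by
  have := Polynomial.prod_X_sub_C_coeff_card_pred
    (Finset.univ : Finset H.ConnectedComponent) (fun K => ((r.onComponent K).card : ℝ))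
    (by rw [Finset.card_univ, ← Nat.card_eq_fintype_card]; omega)
  rwa [Finset.card_univ, ← Nat.card_eq_fintype_card, hj, Nat.add_sub_cancel] at this

open Classical in
theorem restraintPoly_coeff {V : Type*} [Fintype V] (G : SimpleGraph V) (r : Restraint V) (j : ℕ) :
    (restraintPoly G r).coeff j = ∑ S ∈ G.edgeFinset.powerset,
      (-1) ^ S.card * (constPoly r (SimpleGraph.fromEdgeSet (S : Set (Sym2 V)))).coeff j := by
  rw [restraintPoly, Polynomial.finsetSum_coeff]
  refine Finset.sum_congr rfl fun S _ => ?_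
  rcases Nat.even_or_odd S.card with h' | h' <;>
  simp [h'.neg_one_pow]

/-! ### Alternation as a local condition -/

/-- Adjacent vertices have disjoint forbidden sets, and vertices with a common neighbour have
equal forbidden sets. -/
def IsLocallyAlternating {V : Type*} (G : SimpleGraph V) (r : Restraint V) : Prop :=
  (∀ u v, G.Adj u v → Disjoint (r u) (r v)) ∧
    ∀ u v w, G.Adj u v → G.Adj v w → r u = r w

theorem IsLocallyAlternating.of_reachable {V : Type*} {G : SimpleGraph V} {r : Restraint V}
    (h : IsLocallyAlternating G r) (χ : G.Coloring (Fin 2)) {u v : V} (huv : G.Reachable u v) :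
    (χ u = χ v → r u = r v) ∧ (χ u ≠ χ v → Disjoint (r u) (r v)) := by
  -- Induction along a walk needs the extra clause on neighbours: prepending a vertex to an odd walk
  -- must yield equality, not just disjointness.
  suffices (χ u = χ v → r u = r v) ∧
      (χ u ≠ χ v → Disjoint (r u) (r v) ∧ ∀ t, G.Adj t u → r t = r v) from
    ⟨this.1, fun h => (this.2 h).1⟩
  obtain ⟨p⟩ := huv
  induction p with
  | nil => simp
  | @cons t u v htu _ ih =>
    have hχ := χ.valid htu
    refine ⟨fun htv => (ih.2 (fun h => hχ (htv.trans h.symm))).2 t htu, fun htv => ?_⟩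
    have huv : r u = r v := ih.1 (by omega)
    exact ⟨huv ▸ h.1 t u htu, fun s hs => huv ▸ h.2 s t u hs htu⟩

theorem forall_isAlternating_iff {V : Type*} {G : SimpleGraph V} (χ : G.Coloring (Fin 2))
    (r : Restraint V) :
    (∀ C : G.ConnectedComponent, IsAlternating C.toSimpleGraph (r.induced C)) ↔
      IsLocallyAlternating G r := by
  constructor
  · intro h
    refine ⟨fun u v huv => ?_, fun u v w huv hvw => ?_⟩
    · obtain ⟨A, B, ⟨hAB, -⟩, hA, hB, hd⟩ := h (G.connectedComponentMk u)
      have hv : v ∈ G.connectedComponentMk u :=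
        SimpleGraph.ConnectedComponent.sound huv.symm.reachable
      rcases hAB.mem_of_adj (show (G.connectedComponentMk u).toSimpleGraph.Adj ⟨u, rfl⟩ ⟨v, hv⟩ from huv) with ⟨h1, h2⟩ | ⟨h1, h2⟩
      · exact hd _ h1 _ h2
      · exact (hd _ h2 _ h1).symm
    · obtain ⟨A, B, ⟨hAB, -⟩, hA, hB, hd⟩ := h (G.connectedComponentMk u)
      have hv : v ∈ G.connectedComponentMk u :=
        SimpleGraph.ConnectedComponent.sound huv.symm.reachable
      have hw : w ∈ G.connectedComponentMk u :=
        (SimpleGraph.ConnectedComponent.sound hvw.symm.reachable).trans hv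
      rcases hAB.mem_of_adj (show (G.connectedComponentMk u).toSimpleGraph.Adj ⟨u, rfl⟩ ⟨v, hv⟩ from huv) with ⟨h1, h2⟩ | ⟨h1, h2⟩ <;>
      rcases hAB.mem_of_adj (show (G.connectedComponentMk u).toSimpleGraph.Adj ⟨v, hv⟩ ⟨w, hw⟩ from hvw) with ⟨h3, h4⟩ | ⟨h3, h4⟩
      · exact (Set.disjoint_left.1 hAB.disjoint h3 h2).elim
      · exact hA _ h1 _ h4
      · exact hB _ h1 _ h4
      · exact (Set.disjoint_left.1 hAB.disjoint h2 h3).elim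
  · intro h C
    have hr : ∀ u v : C, G.Reachable u v := fun u v =>
      SimpleGraph.ConnectedComponent.exact (u.2.trans v.2.symm)
    refine ⟨{v | χ v = 0}, {v | χ v = 1}, ⟨⟨?_, ?_⟩, ?_⟩, ?_, ?_, ?_⟩
    · exact Set.disjoint_left.2 fun v (h0 : χ v = 0) (h1 : χ v = 1) =>
        zero_ne_one (h0.symm.trans h1)
    · intro u v huv
      have := χ.valid (show G.Adj u v from huv)
      change χ u = 0 ∧ χ v = 1 ∨ χ u = 1 ∧ χ v = 0
      omega
    · refine Set.eq_univ_of_forall fun v => ?_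
      change χ v = 0 ∨ χ v = 1
      omega
    · exact fun u (hu : χ u = 0) v (hv : χ v = 0) =>
        (h.of_reachable χ (hr u v)).1 (hu.trans hv.symm)
    · exact fun u (hu : χ u = 1) v (hv : χ v = 1) =>
        (h.of_reachable χ (hr u v)).1 (hu.trans hv.symm)
    · exact fun u (hu : χ u = 0) v (hv : χ v = 1) =>
        (h.of_reachable χ (hr u v)).2 (by rw [hu, hv]; exact zero_ne_one)

/-! ### Sizes of forbidden unions on components -/

open Classical in
/-- The number of colour classes of `χ` that meet the component `K`. -/
noncomputable def sideCount {V : Type*} [Fintype V] {H : SimpleGraph V} (χ : V → Fin 2)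
    (K : H.ConnectedComponent) : ℕ :=
  ((Finset.univ.filter (fun v => H.connectedComponentMk v = K)).image χ).card

theorem IsLocallyAlternating.card_onComponent {V : Type*} [Fintype V] {G H : SimpleGraph V}
    (hle : H ≤ G) {r : Restraint V} (h : IsLocallyAlternating G r) (χ : G.Coloring (Fin 2))
    {k : ℕ} (hk : ∀ v, (r v).card = k) (K : H.ConnectedComponent) :
    (r.onComponent K).card = sideCount χ K * k := by
  classical
  have hr : ∀ u v, H.connectedComponentMk u = K → H.connectedComponentMk v = K →
      G.Reachable u v := fun u v hu hv =>
    (SimpleGraph.ConnectedComponent.exact (hu.trans hv.symm)).mono hle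
  obtain ⟨g, hg⟩ : ∃ g : Fin 2 → Finset ℕ, ∀ v, H.connectedComponentMk v = K → r v = g (χ v) := by
    refine ⟨fun i => if hi : ∃ v, H.connectedComponentMk v = K ∧ χ v = i then r hi.choose else ∅,
      fun v hv => ?_⟩
    have hi : ∃ w, H.connectedComponentMk w = K ∧ χ w = χ v := ⟨v, hv, rfl⟩
    dsimp only
    rw [dif_pos hi]
    exact (h.of_reachable χ (hr _ _ hv hi.choose_spec.1)).1 hi.choose_spec.2.symm
  set B := Finset.univ.filter (fun v => H.connectedComponentMk v = K) with hB
  have h1 : r.onComponent K = (B.image χ).biUnion g := by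
    rw [Finset.image_biUnion]
    refine Finset.biUnion_congr (by rw [hB]) fun v hv => hg v ?_
    simpa using hv
  rw [h1, Finset.card_biUnion, Finset.sum_const_nat (m := k)]
  · rfl
  · intro i hi
    obtain ⟨v, hv, rfl⟩ := Finset.mem_image.1 hi
    rw [← hg v (by simpa [hB] using hv), hk]
  · intro i hi j hj hij
    obtain ⟨v, hv, rfl⟩ := Finset.mem_image.1 hi
    obtain ⟨w, hw, rfl⟩ := Finset.mem_image.1 hj
    have hv : H.connectedComponentMk v = K := by simpa [hB] using hv
    have hw : H.connectedComponentMk w = K := by simpa [hB] using hw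
    rw [Function.onFun, ← hg v hv, ← hg w hw]
    exact (h.of_reachable χ (hr _ _ hv hw)).2 hij

/-- At most two colour classes occur. If both do, the component contains an edge, whose two disjoint
forbidden sets already supply 2k colours. -/
theorem sideCount_mul_le_card_onComponent {V : Type*} [Fintype V] {G H : SimpleGraph V}
    (hle : H ≤ G) {r : Restraint V} (h : ∀ u v, G.Adj u v → Disjoint (r u) (r v))
    (χ : V → Fin 2) {k : ℕ} (hk : ∀ v, (r v).card = k) (K : H.ConnectedComponent) :
    sideCount χ K * k ≤ (r.onComponent K).card := by
  classical
  have hmem : ∀ v, H.connectedComponentMk v = K → r v ⊆ r.onComponent K := fun v hv i hi =>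
    (r.mem_onComponent K i).2 ⟨v, hv, hi⟩
  have h2 : sideCount χ K ≤ 2 := (Finset.card_le_univ _).trans (by simp)
  by_cases h1 : sideCount χ K ≤ 1
  · obtain ⟨v, hv⟩ := K.exists_rep
    calc sideCount χ K * k ≤ 1 * k := Nat.mul_le_mul_right k h1
      _ = (r v).card := by rw [one_mul, hk]
      _ ≤ _ := Finset.card_le_card (hmem v hv)
  · obtain ⟨i, hi, j, hj, hij⟩ := Finset.one_lt_card.1 (not_le.1 h1)
    obtain ⟨v, hv, rfl⟩ := Finset.mem_image.1 hi
    obtain ⟨w, hw, rfl⟩ := Finset.mem_image.1 hj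
    have hv : H.connectedComponentMk v = K := by simpa using hv
    have hw : H.connectedComponentMk w = K := by simpa using hw
    obtain ⟨p⟩ := SimpleGraph.ConnectedComponent.exact (hv.trans hw.symm)
    cases p with
    | nil => exact (hij rfl).elim
    | @cons _ s _ hvs _ =>
      have hs : H.connectedComponentMk s = K :=
        (SimpleGraph.ConnectedComponent.sound hvs.symm.reachable).trans hv
      calc sideCount χ K * k ≤ 2 * k := Nat.mul_le_mul_right k h2
        _ = (r v ∪ r s).card := by
          rw [Finset.card_union_of_disjoint (h v s (hle hvs)), hk, hk, two_mul]
        _ ≤ _ := Finset.card_le_card (Finset.union_subset (hmem v hv) (hmem s hs))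

theorem card_onComponent_le_sideCount_mul {V : Type*} [Fintype V] {H : SimpleGraph V}
    (r : Restraint V) (χ : V → Fin 2) {k : ℕ} (hk : ∀ v, (r v).card = k)
    (K : H.ConnectedComponent) (hχ : Set.InjOn χ {v | H.connectedComponentMk v = K}) :
    (r.onComponent K).card ≤ sideCount χ K * k := by
  classical
  rw [sideCount, Finset.card_image_of_injOn (by simpa using hχ)]
  exact Finset.card_biUnion_le_card_mul _ _ _ fun v _ => (hk v).le

theorem SimpleGraph.Coloring.injOn_component {V : Type*} {G : SimpleGraph V}
    (χ : G.Coloring (Fin 2)) {S : Finset (Sym2 V)} (hS : (S : Set (Sym2 V)) ⊆ G.edgeSet)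
    (hc : S.card ≤ 1) (K : (SimpleGraph.fromEdgeSet (S : Set (Sym2 V))).ConnectedComponent) :
    Set.InjOn χ {v | (SimpleGraph.fromEdgeSet (S : Set (Sym2 V))).connectedComponentMk v = K} := by
  classical
  intro a ha b hb hab
  by_contra hne
  have h := (show _ = K from ha).trans (show _ = K from hb).symm
  rcases Nat.le_one_iff_eq_zero_or_eq_one.1 hc with h0 | h1
  · rw [Finset.card_eq_zero] at h0
    subst h0
    exact hne (SimpleGraph.eq_of_connectedComponentMk_eq (f := id) (by simp) h)
  · obtain ⟨e, rfl⟩ := Finset.card_eq_one.1 h1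
    induction e with
    | h u v =>
      have huv : G.Adj u v := hS (Finset.mem_coe.2 (Finset.mem_singleton_self _))
      -- Collapsing u onto v is constant on the only edge, so two distinct vertices in one component
      -- must be u and v.
      have key := SimpleGraph.eq_of_connectedComponentMk_eq
        (f := fun x => if x = u then v else x) ?_ h
      · have := χ.valid huv
        split_ifs at key <;> simp_all
      · intro s t hst
        rw [SimpleGraph.fromEdgeSet_adj] at hst
        have := hst.1
        simp only [Finset.coe_singleton, Set.mem_singleton_iff, Sym2.eq_iff] at this
        obtain ⟨rfl, rfl⟩ | ⟨rfl, rfl⟩ := this <;> simp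

/-! ### Comparison with a locally alternating restraint -/

theorem constPoly_congr {V : Type*} [Fintype V] {r s : Restraint V} {H : SimpleGraph V}
    (h : ∀ K : H.ConnectedComponent, (r.onComponent K).card = (s.onComponent K).card) :
    constPoly r H = constPoly s H := by
  simp only [constPoly, h]

theorem Restraint.subset_onComponent {V : Type*} [Fintype V] {H : SimpleGraph V}
    (r : Restraint V) {K : H.ConnectedComponent} {v : V} (hv : H.connectedComponentMk v = K) :
    r v ⊆ r.onComponent K :=
  fun i hi => (r.mem_onComponent K i).2 ⟨v, hv, hi⟩

open Classical in
theorem constPoly_coeff_sub {V : Type*} [Fintype V] (r s : Restraint V)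
    (H : SimpleGraph V) {j : ℕ} (hj : Nat.card H.ConnectedComponent = j + 1) :
    (constPoly r H).coeff j - (constPoly s H).coeff j =
      ∑ K : H.ConnectedComponent, (((s.onComponent K).card : ℝ) - (r.onComponent K).card) := by
  rw [constPoly_coeff_card_pred r H hj, constPoly_coeff_card_pred s H hj, Finset.sum_sub_distrib]
  ring

open Classical in
theorem constPoly_coeff_le {V : Type*} [Fintype V] {r s : Restraint V}
    {H : SimpleGraph V} {j : ℕ} (hj : Nat.card H.ConnectedComponent = j + 1)
    (h : ∀ K : H.ConnectedComponent, (r.onComponent K).card ≤ (s.onComponent K).card) :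
    (constPoly s H).coeff j ≤ (constPoly r H).coeff j := by
  rw [← sub_nonneg, constPoly_coeff_sub r s H hj]
  exact Finset.sum_nonneg fun K _ => sub_nonneg.2 (Nat.cast_le.2 (h K))

open Classical in
theorem constPoly_coeff_lt {V : Type*} [Fintype V] {r s : Restraint V}
    {H : SimpleGraph V} {j : ℕ} (hj : Nat.card H.ConnectedComponent = j + 1)
    (h : ∀ K : H.ConnectedComponent, (r.onComponent K).card ≤ (s.onComponent K).card)
    (K : H.ConnectedComponent) (hK : (r.onComponent K).card < (s.onComponent K).card) :
    (constPoly s H).coeff j < (constPoly r H).coeff j := by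
  rw [← sub_pos, constPoly_coeff_sub r s H hj]
  exact Finset.sum_pos' (fun K _ => sub_nonneg.2 (Nat.cast_le.2 (h K)))
    ⟨K, @Finset.mem_univ _ _ K, sub_pos.2 (Nat.cast_lt.2 hK)⟩

theorem SimpleGraph.fromEdgeSet_le_of_subset {V : Type*} {G : SimpleGraph V} {S : Set (Sym2 V)} (hS : S ⊆ G.edgeSet) :
    SimpleGraph.fromEdgeSet S ≤ G :=
  (SimpleGraph.fromEdgeSet_mono hS).trans (SimpleGraph.fromEdgeSet_edgeSet G).le

/-- With at most one edge, χ is injective on components, so the union bound and the disjointness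
bound meet. -/
theorem constPoly_congr_of_forall_disjoint
    {V : Type*} [Fintype V] {G : SimpleGraph V} (χ : G.Coloring (Fin 2)) {k : ℕ} {s r : Restraint V} (hs : IsLocallyAlternating G s)
    (hsk : ∀ v, (s v).card = k) (hrk : ∀ v, (r v).card = k) {S : Finset (Sym2 V)}
    (hS : (S : Set (Sym2 V)) ⊆ G.edgeSet) (hc : S.card ≤ 1)
    (hr : ∀ u v, s(u, v) ∈ S → Disjoint (r u) (r v)) :
    constPoly s (SimpleGraph.fromEdgeSet (S : Set (Sym2 V))) =
      constPoly r (SimpleGraph.fromEdgeSet (S : Set (Sym2 V))) := by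
  refine constPoly_congr fun K => ?_
  rw [hs.card_onComponent (SimpleGraph.fromEdgeSet_le_of_subset hS) χ hsk]
  exact le_antisymm
    (sideCount_mul_le_card_onComponent le_rfl
      (fun u v huv => hr u v ((SimpleGraph.fromEdgeSet_adj _).1 huv).1) χ hrk K)
    (card_onComponent_le_sideCount_mul r χ hrk K (χ.injOn_component hS hc K))

open Classical in
theorem restraintPoly_sub_coeff {V : Type*} [Fintype V] {G : SimpleGraph V}
    {s r : Restraint V} (j : ℕ) :
    (restraintPoly G s - restraintPoly G r).coeff j = ∑ S ∈ G.edgeFinset.powerset,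
      (-1) ^ S.card * ((constPoly s (SimpleGraph.fromEdgeSet (S : Set (Sym2 V)))).coeff j -
        (constPoly r (SimpleGraph.fromEdgeSet (S : Set (Sym2 V)))).coeff j) := by
  rw [Polynomial.coeff_sub, restraintPoly_coeff, restraintPoly_coeff, ← Finset.sum_sub_distrib]
  exact Finset.sum_congr rfl fun S _ => by ring

theorem eventually_pos_of_not_disjoint
    {V : Type*} [Fintype V] {G : SimpleGraph V} (χ : G.Coloring (Fin 2)) {k : ℕ} {s r : Restraint V} (hs : IsLocallyAlternating G s)
    (hsk : ∀ v, (s v).card = k) (hrk : ∀ v, (r v).card = k) {u v : V} (huv : G.Adj u v)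
    (hr : ¬ Disjoint (r u) (r v)) :
    ∀ᶠ x : ℕ in Filter.atTop, 0 < (restraintPoly G s - restraintPoly G r).eval (x : ℝ) := by
  classical
  -- Ensures that the truncated subtraction n − 2 is genuine.
  have hn : 2 ≤ Fintype.card V := by
    have := Finset.card_le_univ ({u, v} : Finset V)
    rwa [Finset.card_pair huv.ne] at this
  have hzero : ∀ S ∈ G.edgeFinset.powerset, ∀ j, Fintype.card V - 2 ≤ j → S.card ≠ 1 →
      (constPoly s (SimpleGraph.fromEdgeSet (S : Set (Sym2 V)))).coeff j -
        (constPoly r (SimpleGraph.fromEdgeSet (S : Set (Sym2 V)))).coeff j = 0 := by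
    intro S hS j hj h1
    rw [Finset.mem_powerset] at hS
    by_cases h0 : S.card = 0
    · rw [constPoly_congr_of_forall_disjoint χ hs hsk hrk (by simpa using Finset.coe_subset.2 hS)
        (by omega), sub_self]
      rw [Finset.card_eq_zero] at h0
      simp [h0]
    · have := SimpleGraph.card_connectedComponent_add_min_le χ hS
      exact constPoly_coeff_sub_eq_zero _ _ _ (by omega)
  refine Polynomial.eventually_eval_natCast_pos (d := Fintype.card V - 2) ?_ ?_
  · rw [restraintPoly_sub_coeff]
    have hcard : ∀ S ∈ G.edgeFinset.powerset, S.card = 1 →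
        Nat.card (SimpleGraph.fromEdgeSet (S : Set (Sym2 V))).ConnectedComponent =
          Fintype.card V - 2 + 1 := by
      intro S hS h1
      have := SimpleGraph.card_connectedComponent_add_min_le χ (Finset.mem_powerset.1 hS)
      have := SimpleGraph.card_le_card_connectedComponent_add_card S
      omega
    have hle : ∀ S ∈ G.edgeFinset.powerset, S.card = 1 →
        ∀ K : (SimpleGraph.fromEdgeSet (S : Set (Sym2 V))).ConnectedComponent,
          (r.onComponent K).card ≤ (s.onComponent K).card := by
      intro S hS h1 K
      have hS : (S : Set (Sym2 V)) ⊆ G.edgeSet := by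
        simpa using Finset.coe_subset.2 (Finset.mem_powerset.1 hS)
      rw [hs.card_onComponent (SimpleGraph.fromEdgeSet_le_of_subset hS) χ hsk]
      exact card_onComponent_le_sideCount_mul r χ hrk K (χ.injOn_component hS h1.le K)
    refine Finset.sum_pos' ?_ ⟨{s(u, v)}, by simpa using huv, ?_⟩
    · intro S hS
      by_cases h1 : S.card = 1
      · rw [h1, pow_one, neg_one_mul, neg_nonneg, sub_nonpos]
        exact constPoly_coeff_le (hcard S hS h1) (hle S hS h1)
      · rw [hzero S hS _ le_rfl h1, mul_zero]
    · have hS : ({s(u, v)} : Finset (Sym2 V)) ∈ G.edgeFinset.powerset := by simpa using huv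
      have h1 : ({s(u, v)} : Finset (Sym2 V)).card = 1 := Finset.card_singleton _
      rw [h1, pow_one, neg_one_mul, neg_pos, sub_neg]
      set H := SimpleGraph.fromEdgeSet (({s(u, v)} : Finset (Sym2 V)) : Set (Sym2 V)) with hH
      have hadj : H.Adj u v := by simp [hH, huv.ne]
      refine constPoly_coeff_lt (hcard _ hS h1) (hle _ hS h1) (H.connectedComponentMk u) ?_
      -- The component of u is {u, v}, where `r` forbids fewer than 2k colours and `s` at least 2k.
      have hsub : r.onComponent (H.connectedComponentMk u) ⊆ r u ∪ r v := by
        intro i hi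
        obtain ⟨x, hx, hi⟩ := (r.mem_onComponent _ i).1 hi
        have key := SimpleGraph.eq_of_connectedComponentMk_eq
          (f := fun x => if x = u then v else x) ?_ hx
        · rw [Finset.mem_union]
          by_cases hxu : x = u
          · exact Or.inl (hxu ▸ hi)
          · have hxv : x = v := by simpa [hxu] using key
            exact Or.inr (hxv ▸ hi)
        · intro a b hab
          rw [hH, SimpleGraph.fromEdgeSet_adj] at hab
          have := hab.1
          simp only [Finset.coe_singleton, Set.mem_singleton_iff, Sym2.eq_iff] at this
          obtain ⟨rfl, rfl⟩ | ⟨rfl, rfl⟩ := this <;> simp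
      have hsup : s u ∪ s v ⊆ s.onComponent (H.connectedComponentMk u) :=
        Finset.union_subset (s.subset_onComponent rfl)
          (s.subset_onComponent (SimpleGraph.ConnectedComponent.sound hadj.symm.reachable))
      have h2 := Finset.card_le_card hsub
      have h3 := Finset.card_le_card hsup
      rw [Finset.card_union_of_disjoint (hs.1 u v huv), hsk, hsk] at h3
      have h4 := Finset.card_union_add_card_inter (r u) (r v)
      rw [hrk, hrk] at h4
      have h5 : 0 < (r u ∩ r v).card := by
        rwa [Finset.card_pos, ← Finset.not_disjoint_iff_nonempty_inter]
      omega
  · intro j hj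
    rw [restraintPoly_sub_coeff]
    refine Finset.sum_eq_zero fun S hS => ?_
    by_cases h1 : S.card = 1
    · have := SimpleGraph.card_connectedComponent_add_min_le χ (Finset.mem_powerset.1 hS)
      rw [constPoly_coeff_sub_eq_zero _ _ _ (by omega), mul_zero]
    · rw [hzero S hS j hj.le h1, mul_zero]

theorem eventually_pos_of_ne
    {V : Type*} [Fintype V] {G : SimpleGraph V} (χ : G.Coloring (Fin 2)) {k : ℕ} {s r : Restraint V} (hs : IsLocallyAlternating G s)
    (hsk : ∀ v, (s v).card = k) (hrk : ∀ v, (r v).card = k)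
    (hr : ∀ u v, G.Adj u v → Disjoint (r u) (r v)) {u v w : V} (huv : G.Adj u v)
    (hvw : G.Adj v w) (huw : r u ≠ r w) :
    ∀ᶠ x : ℕ in Filter.atTop, 0 < (restraintPoly G s - restraintPoly G r).eval (x : ℝ) := by
  classical
  have hne : u ≠ w := fun h => huw (congrArg r h)
  have hn : 3 ≤ Fintype.card V := by
    have := Finset.card_le_univ ({u, v, w} : Finset V)
    rwa [Finset.card_eq_three.2 ⟨u, v, w, huv.ne, hne, hvw.ne, rfl⟩] at this
  have hzero : ∀ S ∈ G.edgeFinset.powerset, ∀ j, Fintype.card V - 3 ≤ j → S.card ≠ 2 →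
      (constPoly s (SimpleGraph.fromEdgeSet (S : Set (Sym2 V)))).coeff j -
        (constPoly r (SimpleGraph.fromEdgeSet (S : Set (Sym2 V)))).coeff j = 0 := by
    intro S hS j hj h1
    rw [Finset.mem_powerset] at hS
    by_cases h0 : S.card ≤ 1
    · rw [constPoly_congr_of_forall_disjoint χ hs hsk hrk (by simpa using Finset.coe_subset.2 hS)
        h0, sub_self]
      exact fun a b hab => hr a b (by simpa using hS hab)
    · have := SimpleGraph.card_connectedComponent_add_min_le χ hS
      exact constPoly_coeff_sub_eq_zero _ _ _ (by omega)
  refine Polynomial.eventually_eval_natCast_pos (d := Fintype.card V - 3) ?_ ?_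
  · rw [restraintPoly_sub_coeff]
    have hcard : ∀ S ∈ G.edgeFinset.powerset, S.card = 2 →
        Nat.card (SimpleGraph.fromEdgeSet (S : Set (Sym2 V))).ConnectedComponent =
          Fintype.card V - 3 + 1 := by
      intro S hS h1
      have := SimpleGraph.card_connectedComponent_add_min_le χ (Finset.mem_powerset.1 hS)
      have := SimpleGraph.card_le_card_connectedComponent_add_card S
      omega
    have hle : ∀ S ∈ G.edgeFinset.powerset,
        ∀ K : (SimpleGraph.fromEdgeSet (S : Set (Sym2 V))).ConnectedComponent,
          (s.onComponent K).card ≤ (r.onComponent K).card := by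
      intro S hS K
      have hS : (S : Set (Sym2 V)) ⊆ G.edgeSet := by
        simpa using Finset.coe_subset.2 (Finset.mem_powerset.1 hS)
      rw [hs.card_onComponent (SimpleGraph.fromEdgeSet_le_of_subset hS) χ hsk]
      exact sideCount_mul_le_card_onComponent (SimpleGraph.fromEdgeSet_le_of_subset hS) hr χ hrk K
    have hS : ({s(u, v), s(v, w)} : Finset (Sym2 V)) ∈ G.edgeFinset.powerset := by
      simp [Finset.insert_subset_iff, huv, hvw]
    have h1 : ({s(u, v), s(v, w)} : Finset (Sym2 V)).card = 2 := by
      refine Finset.card_pair ?_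
      rw [Ne, Sym2.eq_iff]
      rintro (⟨h, -⟩ | ⟨h, -⟩)
      exacts [huv.ne h, hne h]
    refine Finset.sum_pos' ?_ ⟨_, hS, ?_⟩
    · intro S hS
      by_cases h1 : S.card = 2
      · rw [h1, neg_one_sq, one_mul, sub_nonneg]
        exact constPoly_coeff_le (hcard S hS h1) (hle S hS)
      · rw [hzero S hS _ le_rfl h1, mul_zero]
    · rw [h1, neg_one_sq, one_mul, sub_pos]
      have hSG : ((({s(u, v), s(v, w)} : Finset (Sym2 V)) : Set (Sym2 V))) ⊆ G.edgeSet := by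
        simpa using Finset.coe_subset.2 (Finset.mem_powerset.1 hS)
      set H := SimpleGraph.fromEdgeSet (({s(u, v), s(v, w)} : Finset (Sym2 V)) : Set (Sym2 V))
        with hH
      have hadj : H.Adj u v := by simp [hH, huv.ne]
      have hadj' : H.Adj v w := by simp [hH, hvw.ne]
      refine constPoly_coeff_lt (hcard _ hS h1) (hle _ hS) (H.connectedComponentMk v) ?_
      rw [hs.card_onComponent (SimpleGraph.fromEdgeSet_le_of_subset hSG) χ hsk]
      have h2 : sideCount χ (H.connectedComponentMk v) ≤ 2 :=
        (Finset.card_le_univ _).trans (by simp)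
      -- On the path, `r` forbids at least |r(u) ∪ r(w)| + k > 2k colours, while `s` forbids at most
      -- 2k.
      have hsup : (r u ∪ r w) ∪ r v ⊆ r.onComponent (H.connectedComponentMk v) :=
        Finset.union_subset (Finset.union_subset
          (r.subset_onComponent (SimpleGraph.ConnectedComponent.sound hadj.reachable))
          (r.subset_onComponent (SimpleGraph.ConnectedComponent.sound hadj'.symm.reachable)))
          (r.subset_onComponent rfl)
      have hlt : k < (r u ∪ r w).card := by
        rw [← hrk u]
        refine Finset.card_lt_card (Finset.ssubset_iff_subset_ne.2
          ⟨Finset.subset_union_left, fun h => huw ?_⟩)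
        refine (Finset.eq_of_subset_of_card_le ?_ (by rw [hrk, hrk])).symm
        rw [h]
        exact Finset.subset_union_right
      have h3 := Finset.card_le_card hsup
      rw [Finset.card_union_of_disjoint
        (Finset.disjoint_union_left.2 ⟨hr u v huv, (hr v w hvw).symm⟩), hrk] at h3
      have h4 := Nat.mul_le_mul_right k h2
      omega
  · intro j hj
    rw [restraintPoly_sub_coeff]
    refine Finset.sum_eq_zero fun S hS => ?_
    by_cases h1 : S.card = 2
    · have := SimpleGraph.card_connectedComponent_add_min_le χ (Finset.mem_powerset.1 hS)
      rw [constPoly_coeff_sub_eq_zero _ _ _ (by omega), mul_zero]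
    · rw [hzero S hS j hj.le h1, mul_zero]

theorem restraintPoly_eq_of_isLocallyAlternating {V : Type*} [Fintype V] {G : SimpleGraph V}
    (χ : G.Coloring (Fin 2)) {k : ℕ} {s r : Restraint V} (hs : IsLocallyAlternating G s)
    (hr : IsLocallyAlternating G r) (hsk : ∀ v, (s v).card = k) (hrk : ∀ v, (r v).card = k) :
    restraintPoly G s = restraintPoly G r := by
  classical
  refine Finset.sum_congr rfl fun S hS => ?_
  have hS : (S : Set (Sym2 V)) ⊆ G.edgeSet := by
    simpa using Finset.coe_subset.2 (Finset.mem_powerset.1 hS)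
  rw [constPoly_congr fun K => ?_]
  rw [hs.card_onComponent (SimpleGraph.fromEdgeSet_le_of_subset hS) χ hsk,
    hr.card_onComponent (SimpleGraph.fromEdgeSet_le_of_subset hS) χ hrk]

/-! ### From polynomials back to colouring counts -/

theorem IsKRestraint.eventually_eq_eval {V : Type*} [Fintype V] {k : ℕ} {r : Restraint V}
    (hr : IsKRestraint k r) (G : SimpleGraph V) :
    ∀ᶠ x : ℕ in Filter.atTop, (numPermitted G r x : ℝ) = (restraintPoly G r).eval (x : ℝ) := by
  filter_upwards [Filter.eventually_ge_atTop (k * Fintype.card V)] with x hx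
  exact numPermitted_eq_eval G r x fun v =>
    (hr v).2.trans (Finset.Icc_subset_Icc_right hx)

theorem IsLocallyAlternating.eventually_lt {V : Type*} [Fintype V] {G : SimpleGraph V}
    (χ : G.Coloring (Fin 2)) {k : ℕ} {s r : Restraint V} (hs : IsLocallyAlternating G s)
    (hsk : IsKRestraint k s) (hrk : IsKRestraint k r) (hr : ¬ IsLocallyAlternating G r) :
    ∀ᶠ x : ℕ in Filter.atTop, numPermitted G r x < numPermitted G s x := by
  have hpos : ∀ᶠ x : ℕ in Filter.atTop,
      0 < (restraintPoly G s - restraintPoly G r).eval (x : ℝ) := by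
    by_cases hd : ∀ u v, G.Adj u v → Disjoint (r u) (r v)
    · have : ∃ u v w, G.Adj u v ∧ G.Adj v w ∧ r u ≠ r w := by
        by_contra! h
        exact hr ⟨hd, h⟩
      obtain ⟨u, v, w, huv, hvw, huw⟩ := this
      exact eventually_pos_of_ne χ hs (fun v => (hsk v).1) (fun v => (hrk v).1) hd huv hvw huw
    · push Not at hd
      obtain ⟨u, v, huv, h⟩ := hd
      exact eventually_pos_of_not_disjoint χ hs (fun v => (hsk v).1) (fun v => (hrk v).1) huv h
  filter_upwards [hpos, hsk.eventually_eq_eval G, hrk.eventually_eq_eval G] with x h1 h2 h3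
  rw [Polynomial.eval_sub, ← h2, ← h3, sub_pos] at h1
  exact_mod_cast h1

theorem IsLocallyAlternating.eventually_le {V : Type*} [Fintype V] {G : SimpleGraph V}
    (χ : G.Coloring (Fin 2)) {k : ℕ} {s r : Restraint V} (hs : IsLocallyAlternating G s)
    (hsk : IsKRestraint k s) (hrk : IsKRestraint k r) :
    ∀ᶠ x : ℕ in Filter.atTop, numPermitted G r x ≤ numPermitted G s x := by
  by_cases hr : IsLocallyAlternating G r
  · filter_upwards [hsk.eventually_eq_eval G, hrk.eventually_eq_eval G] with x h2 h3
    rw [← restraintPoly_eq_of_isLocallyAlternating χ hs hr (fun v => (hsk v).1)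
      (fun v => (hrk v).1), ← h2] at h3
    exact_mod_cast h3.le
  · exact (hs.eventually_lt χ hsk hrk hr).mono fun x => le_of_lt

theorem exists_isKRestraint_isLocallyAlternating {V : Type*} [Fintype V] {G : SimpleGraph V}
    (χ : G.Coloring (Fin 2)) (k : ℕ) :
    ∃ s : Restraint V, IsKRestraint k s ∧ IsLocallyAlternating G s := by
  classical
  by_cases h : ∃ u v, G.Adj u v
  · obtain ⟨u, v, huv⟩ := h
    have hn : 2 ≤ Fintype.card V := by
      have := Finset.card_le_univ ({u, v} : Finset V)
      rwa [Finset.card_pair huv.ne] at this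
    -- Two disjoint blocks need 2k colours among 1, …, kn, hence two vertices. The edgeless case
    -- uses a single block, so that n = 1 is covered.
    have hk : k * 2 ≤ k * Fintype.card V := Nat.mul_le_mul_left k hn
    have hdis : Disjoint (Finset.Icc 1 k) (Finset.Icc (k + 1) (k + k)) :=
      Finset.disjoint_left.2 fun i h1 h2 => by
        rw [Finset.mem_Icc] at h1 h2
        omega
    refine ⟨fun v => if χ v = 0 then Finset.Icc 1 k else Finset.Icc (k + 1) (k + k),
      fun v => ?_, fun u v huv => ?_, fun u v w huv hvw => ?_⟩
    · dsimp only
      split_ifs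
      · exact ⟨by simp, Finset.Icc_subset_Icc_right (by omega)⟩
      · exact ⟨by simp, Finset.Icc_subset_Icc (by omega) (by omega)⟩
    · have := χ.valid huv
      dsimp only
      split_ifs with h1 h2 h2
      · omega
      · exact hdis
      · exact hdis.symm
      · omega
    · have h1 := χ.valid huv
      have h2 := χ.valid hvw
      have : χ u = χ w := by omega
      simp only [this]
  · push Not at h
    refine ⟨fun _ => Finset.Icc 1 k, fun v => ⟨by simp, Finset.Icc_subset_Icc_right ?_⟩,
      fun u v huv => (h u v huv).elim, fun u v w huv => (h u v huv).elim⟩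
    exact Nat.le_mul_of_pos_right k (Fintype.card_pos_iff.2 ⟨v⟩)

theorem finite_setOf_isKRestraint (V : Type*) [Fintype V] (k : ℕ) :
    {r : Restraint V | IsKRestraint k r}.Finite := by
  classical
  refine (Fintype.piFinset fun _ : V =>
    (Finset.Icc 1 (k * Fintype.card V)).powerset).finite_toSet.subset fun r hr => ?_
  rw [Finset.mem_coe, Fintype.mem_piFinset]
  exact fun v => Finset.mem_powerset.2 (hr v).2

theorem mainTheorem1 {V : Type*} [Fintype V] (G : SimpleGraph V) (hG : G.IsBipartite)
    (k : ℕ) (r : Restraint V) (hr : IsKRestraint k r) :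
    r ∈ Rmax G k ↔
      ∀ C : G.ConnectedComponent, IsAlternating C.toSimpleGraph (r.induced C) := by
  obtain ⟨χ⟩ := hG
  rw [forall_isAlternating_iff χ]
  constructor
  · rintro ⟨-, N, hN⟩
    by_contra h
    obtain ⟨s, hsk, hs⟩ := exists_isKRestraint_isLocallyAlternating χ k
    obtain ⟨x, hx, hxN⟩ := ((hs.eventually_lt χ hsk hr h).and
      (Filter.eventually_ge_atTop N)).exists
    exact (hN x hxN s hsk).not_gt hx
  · intro h
    refine ⟨hr, Filter.eventually_atTop.1 ?_⟩
    -- There are finitely many k-restraints, so their separate thresholds combine into one.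
    exact (Filter.eventually_all_finite (finite_setOf_isKRestraint V k)).2
      fun r' hr' => h.eventually_le χ hr hr'
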